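/- Consider the $K$-user cache-aided MISO broadcast channel with an $L$-antenna transmitter, $L\ge 1$, and a library of $N\ge K$ equal-sized files. User $k$ receives $y_k=\mathbf h_k^\dagger\mathbf x+w_k$; in each communication block the joint law of the channel vectors $(\mathbf h_1,\dots,\mathbf h_K)\in(\mathbb C^{L})^K$ is absolutely continuous. Files are divided into $F\ge 1$ packets. An uncoded placement gives each user a set of packets whose size is at most a fraction $\gamma\in[0,1]$ of the library; $t=K\gamma$ is the cumulative cache size. For a demand of $K$ distinct files, a one-shot linear delivery consists of communication blocks. In a block the transmitter serves a set of users, sending to each of them one packet of its requested file that it has not cached, through a linear combination $\mathbf x=\sum_i s_i\mathbf p_i$ of the packets' coded symbols $s_i$. The precoders $\mathbf p_i$ are (measurable) functions of the channel vectors of those served users that feed back their channels. Almost surely, each served user must recover its symbol, up to a multiple of the noise, as a linear combination of $y_k$ and of the symbols of packets it has cached. Every requested packet missing at its user is sent to it in exactly one block. The feedback cost is at most $C$ if in every block at most $C$ users feed back their channels and at most $C$ distinct precoders are used; full CSIT means $C=K$. Let $\mathcal T^\star_L(t,C)$ be the infimum over $F$ and over placements of the maximum over demands of the least number of blocks divided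 by $F$, and let the optimal one-shot linear DoF be $\mathcal D_L(t,C)=K(1-\gamma)/\mathcal T^\star_L(t,C)$. Then for every integer $t$ with $0\le t<K$, the optimal DoF with full CSIT is $$\mathcal D_L(t)=\min\{L+t,\,K\},$$ that is, exactly $L+t$ whenever $L+t\le K$; and the same value $\mathcal D_L(t,C)=\min\{L+t,K\}$ is already the optimum for every feedback cost $C\ge L$, in particular for $C=L$. Moreover, for every real $\gamma\in[0,1]$ and every $C$, $\mathcal D_L(t,C)\le L+t$ (with $\mathcal D_L(t,C)$ read as $0$ when $\gamma=1$). -/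

import Mathlib

open MeasureTheory
open scoped ENNReal

noncomputable section

namespace CacheMISO

/-- A channel realization: row `k` is the channel vector `h_k ∈ ℂ^L` of user `k`. -/
abbrev Channel (K L : ℕ) : Type := Fin K → Fin L → ℂ

/-- An uncoded placement: each of the `K` users stores a set of packets. The library has
`N` files of `F` packets each; the packet `(n, f)` is the `f`-th packet of file `n`. -/
abbrev Placement (K N F : ℕ) : Type := Fin K → Finset (Fin N × Fin F)

/-- Every user stores at most a fraction `γ` of the library. -/
def Placement.Fits {K N F : ℕ} (Z : Placement K N F) (γ : ℝ) : Prop :=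
  ∀ k, ((Z k).card : ℝ) ≤ γ * ((N : ℝ) * (F : ℝ))

/-- One communication block of a one-shot linear scheme. Each user `k ∈ served` is sent the
packet `packet k` of its requested file (the value of `packet` off `served` plays no role);
`feedback` is the set of users whose channel vectors the transmitter knows; the beamforming
vector of user `k`'s packet is a function of those channel vectors only. -/
structure Block (K L F : ℕ) where
  served : Finset (Fin K)
  packet : Fin K → Fin F
  feedback : Finset (Fin K)
  precoder : Fin K → ({j // j ∈ feedback} → Fin L → ℂ) → Fin L → ℂ

variable {K N L F : ℕ}

/-- The transmitted vector `x ∈ ℂ^L`: the linear combination of the scheduled (channel-coded)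
packets, where `s i` is the symbol of the packet intended for user `i`. -/
def Block.transmitted (B : Block K L F) (H : Channel K L) (s : Fin K → ℂ) : Fin L → ℂ :=
  ∑ i ∈ B.served, s i • B.precoder i (fun j => H j)

/-- The received signal `y = h† x + w`. -/
def received (h x : Fin L → ℂ) (w : ℂ) : ℂ := star h ⬝ᵥ x + w

/-- User `k` obtains its desired symbol, up to a multiple of the noise, by a linear combination
of its received signal and of the scheduled packets that it has cached. -/
def Block.DecodableAt (B : Block K L F) (Z : Placement K N F) (d : Fin K ↪ Fin N)
    (H : Channel K L) (k : Fin K) : Prop :=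
  ∃ (a : ℂ) (c : Fin K → ℂ),
    (∀ i, (d i, B.packet i) ∉ Z k → c i = 0) ∧
    ∀ (s : Fin K → ℂ) (w : ℂ),
      a * received (H k) (B.transmitted H s) w + ∑ i ∈ B.served, c i * s i = s k + a * w

/-- The block is admissible at feedback cost `C` for the demand `d`: only packets missing at their
intended users are sent, at most `C` of the served users feed back their channels, at most `C`
different precoders are used, and almost surely every served user decodes its packet. -/
structure Block.Admissible (B : Block K L F) (μ : Measure (Channel K L)) (C : ℕ)
    (Z : Placement K N F) (d : Fin K ↪ Fin N) : Prop where
  needed : ∀ k ∈ B.served, (d k, B.packet k) ∉ Z k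
  feedback_subset : B.feedback ⊆ B.served
  feedback_card : B.feedback.card ≤ C
  precoder_card : (B.precoder '' (B.served : Set (Fin K))).ncard ≤ C
  precoder_measurable : ∀ k ∈ B.served, Measurable (B.precoder k)
  decodable : ∀ᵐ H ∂μ, ∀ k ∈ B.served, B.DecodableAt Z d H k

/-- `T` communication blocks of feedback cost at most `C` serve the demand `d`: every requested
packet that is missing at its user is sent to that user in exactly one block. -/
def Deliverable (μ : Measure (Channel K L)) (C : ℕ) (Z : Placement K N F) (d : Fin K ↪ Fin N)
    (T : ℕ) : Prop :=
  ∃ B : Fin T → Block K L F,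
    (∀ b, (B b).Admissible μ C Z d) ∧
    ∀ k f, (d k, f) ∉ Z k → ∃! b, k ∈ (B b).served ∧ (B b).packet k = f

/-- The minimum one-shot linear delivery time of a placement for the worst case of distinct
demands, in units of `F` communication blocks. -/
def placementTime (μ : Measure (Channel K L)) (C : ℕ) (Z : Placement K N F) : ℝ≥0∞ :=
  ⨆ d : Fin K ↪ Fin N, ⨅ (T : ℕ) (_ : Deliverable μ C Z d T), (T : ℝ≥0∞) / (F : ℝ≥0∞)

/-- The optimal worst-case delivery time: the infimum over all subdivisions of the files into
`F ≥ 1` packets and all uncoded placements with caches of normalized size `γ`. -/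
def deliveryTime (N : ℕ) (μ : Measure (Channel K L)) (γ : ℝ) (C : ℕ) : ℝ≥0∞ :=
  ⨅ (F : ℕ) (_ : 0 < F) (Z : Placement K N F) (_ : Z.Fits γ), placementTime μ C Z

/-- The optimal one-shot linear DoF, `K (1 - γ)` divided by the optimal delivery time, when the
feedback cost of each transmission is at most `C`. -/
def optimalDoF (N : ℕ) (μ : Measure (Channel K L)) (γ : ℝ) (C : ℕ) : ℝ≥0∞ :=
  ENNReal.ofReal ((K : ℝ) * (1 - γ)) / deliveryTime N μ γ C

/-- The optimal one-shot linear DoF with full CSIT: all `K` users may feed back their channels. -/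
def fullDoF (N : ℕ) (μ : Measure (Channel K L)) (γ : ℝ) : ℝ≥0∞ :=
  optimalDoF N μ γ K

end CacheMISO

end

/-!
The only property of the channel that matters is that almost surely all its minors are nonzero.

*Converse.* If a packet of a block is cached by `m` users, its precoder is orthogonal to the
channels of all other served users except the intended one. By genericity there are fewer than `L`
of them, so the block serves at most `L + m` users. Weighting each packet by `1 / (L + m)`, every
block thus carries weight at most one, and the total weight of the packets to be delivered bounds
the number of blocks. Averaging over the cyclic shifts of a demand, in which every file is requested
equally often by every user, expresses this bound through the average of `(K - m) / (L + m)` over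
the library, a convex decreasing function of `m`, while the average of `m` is at most `K γ`. The
weight `1 / K` gives the bound `K` in the same way.

*Achievability.* Cut the files into packets labelled by the arrangements of the users into `t`
caching slots and `K - t` others. In each block serve the `t` caching users of an arrangement
together with `n = min L (K - t)` others, and zero-force over the channels of these `n` users only,
so that the cached contents take care of all the remaining interference.
-/

namespace CacheMISO

open scoped Matrix

variable {K N L F : ℕ}

section Genericity

variable {m n R : Type*}

/-- All minors of the matrix are nonzero. This is the form in which genericity of the channel
vectors is used throughout. -/
def IsTotallyNonsingular [CommRing R] (A : Matrix m n R) : Prop :=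
  ∀ ⦃s : ℕ⦄ (ρ : Fin s ↪ m) (κ : Fin s ↪ n), (A.submatrix ρ κ).det ≠ 0

theorem IsTotallyNonsingular.map {S : Type*} [CommRing R] [CommRing S] {A : Matrix m n R}
    (hA : IsTotallyNonsingular A) {f : R →+* S} (hf : Function.Injective f) :
    IsTotallyNonsingular (A.map f) := fun s ρ κ => by
  rw [Matrix.submatrix_map, ← RingHom.mapMatrix_apply, ← RingHom.map_det]
  exact (map_ne_zero_iff f hf).2 (hA ρ κ)

theorem exists_embedding_forall_mem {α : Type*} {S : Finset α} {n : ℕ} (h : n ≤ S.card) :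
    ∃ ρ : Fin n ↪ α, ∀ i, ρ i ∈ S :=
  ⟨(Fin.castLEEmb h).trans (S.equivFin.symm.toEmbedding.trans (.subtype _)),
    fun _ => Subtype.prop _⟩

theorem IsTotallyNonsingular.eq_zero_of_mulVec_eq_zero [CommRing R] [IsDomain R] [Fintype n]
    {A : Matrix m n R} (hA : IsTotallyNonsingular A) {S : Finset m}
    (hS : Fintype.card n ≤ S.card) {x : n → R} (hx : ∀ i ∈ S, (A *ᵥ x) i = 0) : x = 0 := by
  obtain ⟨ρ, hρ⟩ := exists_embedding_forall_mem hS
  let κ := Fintype.equivFin n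
  have hsub : A.submatrix ρ κ.symm *ᵥ (x ∘ κ.symm) = 0 := by
    ext i
    simpa [Matrix.submatrix_mulVec_equiv, Function.comp_assoc] using hx (ρ i) (hρ i)
  have hcomp := Matrix.eq_zero_of_mulVec_eq_zero (hA ρ κ.symm.toEmbedding) hsub
  simpa [Function.comp_assoc] using congrArg (· ∘ κ) hcomp

theorem vecMul_adjugate_apply [CommRing R] [Fintype n] [DecidableEq n] (A : Matrix n n R)
    (u : n → R) (i : n) : (u ᵥ* A.adjugate) i = (A.updateRow i u).det := by
  rw [← Matrix.cramer_transpose_apply, Matrix.cramer_eq_adjugate_mulVec,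
    ← Matrix.adjugate_transpose, Matrix.mulVec_transpose]

variable {𝕜 : Type*} [NontriviallyNormedField 𝕜] [ProperSpace 𝕜] [MeasurableSpace 𝕜]
  [BorelSpace 𝕜] [Finite m] [Finite n]

theorem ae_det_submatrix_ne_zero (ν : Measure (m → n → 𝕜)) [ν.IsAddHaarMeasure] {s : ℕ}
    (ρ : Fin s ↪ m) (κ : Fin s ↪ n) : ∀ᵐ A ∂ν, ((Matrix.of A).submatrix ρ κ).det ≠ 0 := by
  classical
  have := Fintype.ofFinite m
  have := Fintype.ofFinite n
  let P : m → n → 𝕜 := fun i j => if ∃ a, ρ a = i ∧ κ a = j then 1 else 0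
  have hP : (Matrix.of P).submatrix ρ κ = 1 := by
    ext a b
    simp [P, Matrix.one_apply]
  have hmeas : MeasurableSet {A : m → n → 𝕜 | ((Matrix.of A).submatrix ρ κ).det ≠ 0} := by
    have : Continuous fun A : m → n → 𝕜 => ((Matrix.of A).submatrix ρ κ).det := by fun_prop
    exact (isOpen_ne.preimage this).measurableSet
  -- Along a line of direction `P`, the minor vanishes only at finitely many points: eigenvalues.
  suffices hline : ∀ A, ∀ᵐ x ∂(Measure.addHaar : Measure 𝕜),
      ((Matrix.of (A + x • P)).submatrix ρ κ).det ≠ 0 from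
    ae_mem_of_ae_add_linearMap_mem (LinearMap.toSpanSingleton 𝕜 _ P) Measure.addHaar ν hmeas hline
  intro A
  have hfin := Matrix.finite_spectrum (-(Matrix.of A).submatrix ρ κ)
  filter_upwards [hfin.countable.ae_notMem _] with x hx
  have hsub : (Matrix.of (A + x • P)).submatrix ρ κ =
      algebraMap 𝕜 _ x - -(Matrix.of A).submatrix ρ κ := by
    rw [sub_neg_eq_add, add_comm, Algebra.algebraMap_eq_smul_one, ← hP]
    rfl
  rw [hsub]
  rwa [spectrum.notMem_iff, Matrix.isUnit_iff_isUnit_det, isUnit_iff_ne_zero] at hx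

theorem ae_isTotallyNonsingular (ν : Measure (m → n → 𝕜)) [ν.IsAddHaarMeasure] :
    ∀ᵐ A ∂ν, IsTotallyNonsingular (Matrix.of A) := by
  simp only [IsTotallyNonsingular, ae_all_iff]
  exact fun s ρ κ => ae_det_submatrix_ne_zero ν ρ κ

theorem ae_isTotallyNonsingular_channel {μ : Measure (Channel K L)} (hμ : μ ≪ volume) :
    ∀ᵐ H ∂μ, IsTotallyNonsingular (Matrix.of H) := by
  have : (volume : Measure (Fin L → ℂ)).IsAddHaarMeasure :=
    Measure.pi.isAddHaarMeasure fun _ => volume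
  have : (volume : Measure (Channel K L)).IsAddHaarMeasure :=
    Measure.pi.isAddHaarMeasure fun _ => volume
  exact hμ.ae_le (ae_isTotallyNonsingular (m := Fin K) (n := Fin L) (𝕜 := ℂ) volume)

end Genericity

section Decoding

/-- The matrix with rows `h_k†`, which maps the transmitted vector to the noiseless received
signals. -/
def conjChannel (H : Channel K L) : Matrix (Fin K) (Fin L) ℂ :=
  (Matrix.of H).map (starRingEnd ℂ)

theorem isTotallyNonsingular_conjChannel {H : Channel K L}
    (hH : IsTotallyNonsingular (Matrix.of H)) : IsTotallyNonsingular (conjChannel H) :=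
  hH.map (starRingEnd ℂ).injective

/-- The effective channel gain `h_k† p_i` of user `i`'s packet at user `k`. -/
def Block.gain (B : Block K L F) (H : Channel K L) (k i : Fin K) : ℂ :=
  (conjChannel H *ᵥ B.precoder i fun j => H j) k

theorem Block.received_transmitted (B : Block K L F) (H : Channel K L) (k : Fin K)
    (s : Fin K → ℂ) (w : ℂ) :
    received (H k) (B.transmitted H s) w = ∑ i ∈ B.served, s i * B.gain H k i + w := by
  simp only [received, transmitted, dotProduct_sum, dotProduct_smul, smul_eq_mul]
  rfl

theorem Block.decodableAt_iff_exists_coeff (B : Block K L F) (Z : Placement K N F)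
    (d : Fin K ↪ Fin N) (H : Channel K L) {k : Fin K} (hk : k ∈ B.served) :
    B.DecodableAt Z d H k ↔ ∃ (a : ℂ) (c : Fin K → ℂ), (∀ i, (d i, B.packet i) ∉ Z k → c i = 0) ∧
      ∀ i ∈ B.served, a * B.gain H k i + c i = if i = k then 1 else 0 := by
  refine exists₂_congr fun a c => and_congr_right fun _ => ⟨fun h i hi => ?_, fun h s w => ?_⟩
  · simpa [received_transmitted, Pi.single_apply, hi, eq_comm] using h (Pi.single i 1) 0
  · calc a * received (H k) (B.transmitted H s) w + ∑ i ∈ B.served, c i * s i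
        = ∑ i ∈ B.served, s i * (a * B.gain H k i + c i) + a * w := by
          rw [received_transmitted, mul_add, add_right_comm, Finset.mul_sum,
            ← Finset.sum_add_distrib]
          congr! 2
          ring
      _ = ∑ i ∈ B.served, s i * (if i = k then 1 else 0) + a * w := by
          rw [Finset.sum_congr rfl fun i hi => by rw [h i hi]]
      _ = s k + a * w := by simp [hk]

theorem Block.decodableAt_iff (B : Block K L F) (Z : Placement K N F) (d : Fin K ↪ Fin N)
    (H : Channel K L) {k : Fin K} (hk : k ∈ B.served) (hneed : (d k, B.packet k) ∉ Z k) :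
    B.DecodableAt Z d H k ↔ B.gain H k k ≠ 0 ∧
      ∀ i ∈ B.served, i ≠ k → (d i, B.packet i) ∉ Z k → B.gain H k i = 0 := by
  classical
  rw [B.decodableAt_iff_exists_coeff Z d H hk]
  constructor
  · rintro ⟨a, c, hc, hcoeff⟩
    have hgain : a * B.gain H k k = 1 := by simpa [hc k hneed] using hcoeff k hk
    refine ⟨right_ne_zero_of_mul_eq_one hgain, fun i hi hik hZ => ?_⟩
    have hzero : a * B.gain H k i = 0 := by simpa [hc i hZ, hik] using hcoeff i hi
    exact (mul_eq_zero.1 hzero).resolve_left (left_ne_zero_of_mul_eq_one hgain)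
  · rintro ⟨hgain, hnull⟩
    refine ⟨(B.gain H k k)⁻¹,
      fun i => if (d i, B.packet i) ∈ Z k then -((B.gain H k k)⁻¹ * B.gain H k i) else 0,
      fun i hi => if_neg hi, fun i hi => ?_⟩
    rcases eq_or_ne i k with rfl | hik
    · simp [hneed, hgain]
    · by_cases hZ : (d i, B.packet i) ∈ Z k
      · simp [hZ, hik]
      · simp [hZ, hik, hnull i hi hik hZ]

end Decoding

section Converse

/-- The number of users caching the packet `p`. -/
def Placement.multiplicity (Z : Placement K N F) (p : Fin N × Fin F) : ℕ :=
  (Finset.univ.filter fun k => p ∈ Z k).card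

theorem Placement.sum_multiplicity (Z : Placement K N F) :
    ∑ p, Z.multiplicity p = ∑ k, (Z k).card := by
  simp only [multiplicity, Finset.card_filter]
  rw [Finset.sum_comm]
  simp

theorem Placement.Fits.sum_multiplicity_le {Z : Placement K N F} {γ : ℝ} (hZ : Z.Fits γ) :
    ∑ p, (Z.multiplicity p : ℝ) ≤ N * F * (K * γ) :=
  calc ∑ p, (Z.multiplicity p : ℝ) = ∑ k, ((Z k).card : ℝ) := by exact_mod_cast Z.sum_multiplicity
    _ ≤ ∑ _k : Fin K, γ * (N * F) := Finset.sum_le_sum fun k _ => hZ k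
    _ = N * F * (K * γ) := by
      rw [Finset.sum_const, Finset.card_fin, nsmul_eq_mul]
      ring

theorem Placement.natCast_sub_multiplicity (Z : Placement K N F) (p : Fin N × Fin F) :
    (K : ℝ) - Z.multiplicity p = (Finset.univ.filter fun k => p ∉ Z k).card := by
  have hcard := Finset.card_filter_add_card_filter_not (s := (Finset.univ : Finset (Fin K)))
    fun k => p ∈ Z k
  rw [Finset.card_fin] at hcard
  rw [sub_eq_iff_eq_add', multiplicity]
  exact_mod_cast hcard.symm

theorem Block.card_served_le (B : Block K L F) {Z : Placement K N F} {d : Fin K ↪ Fin N}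
    {H : Channel K L} (hH : IsTotallyNonsingular (Matrix.of H))
    (hneed : ∀ k ∈ B.served, (d k, B.packet k) ∉ Z k)
    (hdec : ∀ k ∈ B.served, B.DecodableAt Z d H k) {i : Fin K} (hi : i ∈ B.served) :
    B.served.card ≤ L + Z.multiplicity (d i, B.packet i) := by
  classical
  by_contra! hlt
  set cachers := Finset.univ.filter fun k => (d i, B.packet i) ∈ Z k with hcachers
  have hdecode := fun k hk => (B.decodableAt_iff Z d H hk (hneed k hk)).1 (hdec k hk)
  have hnulled : Fintype.card (Fin L) ≤ (B.served.erase i \ cachers).card := by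
    have hsdiff := Finset.le_card_sdiff cachers (B.served.erase i)
    rw [Finset.card_erase_of_mem hi] at hsdiff
    rw [Fintype.card_fin]
    rw [Placement.multiplicity, ← hcachers] at hlt
    omega
  have hprecoder : (B.precoder i fun j => H j) = 0 := by
    refine (isTotallyNonsingular_conjChannel hH).eq_zero_of_mulVec_eq_zero hnulled fun k hk => ?_
    simp only [hcachers, Finset.mem_sdiff, Finset.mem_erase, Finset.mem_filter, Finset.mem_univ,
      true_and] at hk
    obtain ⟨⟨hki, hks⟩, hkZ⟩ := hk
    exact (hdecode k hks).2 i hi hki.symm hkZ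
  exact (hdecode i hi).1 (by rw [Block.gain, hprecoder, Matrix.mulVec_zero, Pi.zero_apply])

theorem Block.Admissible.card_served_le {B : Block K L F} {μ : Measure (Channel K L)}
    [NeZero μ] (hμ : ∀ᵐ H ∂μ, IsTotallyNonsingular (Matrix.of H)) {C : ℕ} {Z : Placement K N F}
    {d : Fin K ↪ Fin N} (hB : B.Admissible μ C Z d) {i : Fin K} (hi : i ∈ B.served) :
    B.served.card ≤ L + Z.multiplicity (d i, B.packet i) := by
  obtain ⟨H, hH, hdec⟩ := (hμ.and hB.decodable).exists
  exact B.card_served_le hH hB.needed hdec hi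

theorem sum_le_one_of_card_mul_le_one {α : Type*} {S : Finset α} {f : α → ℝ}
    (h : ∀ i ∈ S, (S.card : ℝ) * f i ≤ 1) : ∑ i ∈ S, f i ≤ 1 := by
  rcases S.eq_empty_or_nonempty with rfl | hS
  · simp
  · have hcard : (0 : ℝ) < S.card := by exact_mod_cast hS.card_pos
    calc ∑ i ∈ S, f i ≤ S.card • (1 / (S.card : ℝ)) :=
          Finset.sum_le_card_nsmul S f _ fun i hi => (le_div_iff₀' hcard).2 (h i hi)
      _ = 1 := by rw [nsmul_eq_mul, mul_one_div_cancel hcard.ne']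

theorem Deliverable.sum_weight_le {μ : Measure (Channel K L)} {C : ℕ} {Z : Placement K N F}
    {d : Fin K ↪ Fin N} {T : ℕ} (h : Deliverable μ C Z d T) {φ : Fin N × Fin F → ℝ}
    (hφ : ∀ p, 0 ≤ φ p)
    (hB : ∀ B : Block K L F, B.Admissible μ C Z d → ∑ k ∈ B.served, φ (d k, B.packet k) ≤ 1) :
    ∑ k, ∑ f, (if (d k, f) ∈ Z k then 0 else φ (d k, f)) ≤ T := by
  classical
  obtain ⟨B, hadm, hsent⟩ := h
  have hnonneg : ∀ k f b,
      0 ≤ if k ∈ (B b).served ∧ (B b).packet k = f then φ (d k, f) else 0 :=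
    fun k f b => ite_nonneg (hφ _) le_rfl
  calc ∑ k, ∑ f, (if (d k, f) ∈ Z k then 0 else φ (d k, f))
      ≤ ∑ k, ∑ f, ∑ b, (if k ∈ (B b).served ∧ (B b).packet k = f then φ (d k, f) else 0) := by
        refine Finset.sum_le_sum fun k _ => Finset.sum_le_sum fun f _ => ?_
        split_ifs with hk
        · exact Finset.sum_nonneg fun b _ => hnonneg k f b
        · obtain ⟨b, hb, -⟩ := hsent k f hk
          exact (if_pos hb).ge.trans
            (Finset.single_le_sum (fun b _ => hnonneg k f b) (Finset.mem_univ b))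
    _ = ∑ b, ∑ k ∈ (B b).served, φ (d k, (B b).packet k) := by
        simp_rw [Finset.sum_comm (s := (Finset.univ : Finset (Fin F)))]
        rw [Finset.sum_comm]
        simp [ite_and]
    _ ≤ ∑ _b : Fin T, 1 := Finset.sum_le_sum fun b _ => hB _ (hadm b)
    _ = T := by simp

/-- The demand of `K` consecutive files, cyclically, starting from file `j`: over all `j`, each
user requests each file once. -/
def shiftDemand [NeZero N] (h : K ≤ N) (j : Fin N) : Fin K ↪ Fin N :=
  (Fin.castLEEmb h).trans (addRightEmbedding j)

theorem sum_shiftDemand [NeZero N] (hN : K ≤ N) (Z : Placement K N F) (φ : Fin N × Fin F → ℝ) :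
    ∑ j, ∑ k, ∑ f, (if (shiftDemand hN j k, f) ∈ Z k then 0 else φ (shiftDemand hN j k, f)) =
      ∑ p, ((K : ℝ) - Z.multiplicity p) * φ p := by
  have huser : ∀ k, ∑ j, ∑ f, (if (shiftDemand hN j k, f) ∈ Z k then 0
      else φ (shiftDemand hN j k, f)) = ∑ p, if p ∈ Z k then 0 else φ p := fun k => by
    rw [Fintype.sum_prod_type]
    exact Equiv.sum_comp (Equiv.addLeft (Fin.castLE hN k))
      fun n => ∑ f, if (n, f) ∈ Z k then 0 else φ (n, f)
  rw [Finset.sum_comm, Finset.sum_congr rfl fun k _ => huser k, Finset.sum_comm]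
  refine Finset.sum_congr rfl fun p _ => ?_
  rw [Z.natCast_sub_multiplicity, Finset.sum_ite, Finset.sum_const_zero, zero_add,
    Finset.sum_const, nsmul_eq_mul]

theorem ofReal_le_placementTime [NeZero N] {μ : Measure (Channel K L)} {C : ℕ} (hN : K ≤ N)
    (hF : 0 < F) (Z : Placement K N F) {φ : Fin N × Fin F → ℝ} (hφ : ∀ p, 0 ≤ φ p)
    (hB : ∀ (d : Fin K ↪ Fin N) (B : Block K L F), B.Admissible μ C Z d → ∀ i ∈ B.served,
      (B.served.card : ℝ) * φ (d i, B.packet i) ≤ 1)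
    {τ : ℝ} (hτ : N * F * τ ≤ ∑ p, ((K : ℝ) - Z.multiplicity p) * φ p) :
    ENNReal.ofReal τ ≤ placementTime μ C Z := by
  obtain ⟨j, -, hj⟩ : ∃ j ∈ (Finset.univ : Finset (Fin N)), F * τ ≤
      ∑ k, ∑ f, (if (shiftDemand hN j k, f) ∈ Z k then 0 else φ (shiftDemand hN j k, f)) := by
    refine Finset.exists_le_of_sum_le Finset.univ_nonempty ?_
    rwa [sum_shiftDemand, Finset.sum_const, Finset.card_fin, nsmul_eq_mul, ← mul_assoc]
  refine le_iSup_of_le (shiftDemand hN j) (le_iInf₂ fun T hT => ?_)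
  have hT_le : F * τ ≤ T :=
    hj.trans (hT.sum_weight_le hφ fun B h => sum_le_one_of_card_mul_le_one (hB _ B h))
  have hF' : (0 : ℝ) < F := by exact_mod_cast hF
  rw [← ENNReal.ofReal_natCast T, ← ENNReal.ofReal_natCast F, ← ENNReal.ofReal_div_of_pos hF']
  exact ENNReal.ofReal_le_ofReal ((le_div_iff₀' hF').2 hT_le)

theorem card_div_le_sum_inv {ι : Type*} [Fintype ι] {g : ι → ℝ} (hg : ∀ i, 0 < g i) {c : ℝ}
    (hsum : ∑ i, g i ≤ Fintype.card ι * c) : Fintype.card ι / c ≤ ∑ i, (g i)⁻¹ := by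
  rcases isEmpty_or_nonempty ι with _ | _
  · simp
  have hcard : (0 : ℝ) < Fintype.card ι := by exact_mod_cast Fintype.card_pos
  have hpos : 0 < ∑ i, g i := Finset.sum_pos (fun i _ => hg i) Finset.univ_nonempty
  calc (Fintype.card ι : ℝ) / c = Fintype.card ι ^ 2 / (Fintype.card ι * c) := by
        rw [sq, mul_div_mul_left _ _ hcard.ne']
    _ ≤ Fintype.card ι ^ 2 / ∑ i, g i := by gcongr
    _ = (∑ _i : ι, 1) ^ 2 / ∑ i, g i := by simp
    _ ≤ ∑ i, 1 ^ 2 / g i := Finset.sq_sum_div_le_sum_sq_div _ _ fun i _ => hg i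
    _ = ∑ i, (g i)⁻¹ := by simp

theorem card_mul_div_le_sum_sub_mul_inv {ι : Type*} [Fintype ι] {f : ι → ℝ} {a b c : ℝ}
    (hf : ∀ i, 0 < b + f i) (hab : 0 ≤ a + b) (hc : 0 < b + c)
    (hsum : ∑ i, f i ≤ Fintype.card ι * c) :
    Fintype.card ι * ((a - c) / (b + c)) ≤ ∑ i, (a - f i) * (b + f i)⁻¹ := by
  have hharmonic : Fintype.card ι / (b + c) ≤ ∑ i, (b + f i)⁻¹ := by
    refine card_div_le_sum_inv hf ?_
    simpa [Finset.sum_add_distrib, mul_add] using hsum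
  calc Fintype.card ι * ((a - c) / (b + c))
      = (a + b) * (Fintype.card ι / (b + c)) - Fintype.card ι := by
        field_simp
        ring
    _ ≤ (a + b) * ∑ i, (b + f i)⁻¹ - Fintype.card ι := by gcongr
    _ = ∑ i, ((a + b) * (b + f i)⁻¹ - 1) := by simp [Finset.mul_sum]
    _ = ∑ i, (a - f i) * (b + f i)⁻¹ := by
        refine Finset.sum_congr rfl fun i _ => ?_
        field_simp [(hf i).ne']
        ring

theorem div_le_deliveryTime {μ : Measure (Channel K L)} [NeZero μ]
    (hμ : ∀ᵐ H ∂μ, IsTotallyNonsingular (Matrix.of H)) (hL : 1 ≤ L) (hN : K ≤ N) {γ : ℝ}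
    (hγ : 0 ≤ γ) (C : ℕ) :
    ENNReal.ofReal (K * (1 - γ) / (L + K * γ)) ≤ deliveryTime N μ γ C := by
  rcases Nat.eq_zero_or_pos K with rfl | hK
  · simp
  have : NeZero N := ⟨by omega⟩
  have : (0 : ℝ) < L := by exact_mod_cast hL
  refine le_iInf₂ fun F hF => le_iInf₂ fun Z hZ => ?_
  refine ofReal_le_placementTime hN hF Z (φ := fun p => ((L : ℝ) + Z.multiplicity p)⁻¹)
    (fun _ => by positivity) (fun d B hB i hi => ?_) ?_
  · rw [← div_eq_mul_inv]
    refine div_le_one_of_le₀ ?_ (by positivity)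
    exact_mod_cast hB.card_served_le hμ hi
  · have haverage := card_mul_div_le_sum_sub_mul_inv (f := fun p => (Z.multiplicity p : ℝ))
      (a := K) (b := L) (c := K * γ) (fun _ => by positivity) (by positivity) (by positivity)
      (by simpa using hZ.sum_multiplicity_le)
    simpa [mul_sub] using haverage

theorem ofReal_one_sub_le_deliveryTime (μ : Measure (Channel K L)) (hK : 0 < K) (hN : K ≤ N)
    (γ : ℝ) (C : ℕ) : ENNReal.ofReal (1 - γ) ≤ deliveryTime N μ γ C := by
  have : NeZero N := ⟨by omega⟩
  have hK' : (0 : ℝ) < K := by exact_mod_cast hK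
  refine le_iInf₂ fun F hF => le_iInf₂ fun Z hZ => ?_
  refine ofReal_le_placementTime hN hF Z (φ := fun _ => (K : ℝ)⁻¹)
    (fun _ => by positivity) (fun d B _ i _ => ?_) ?_
  · rw [← div_eq_mul_inv]
    refine div_le_one_of_le₀ ?_ hK'.le
    exact_mod_cast card_finset_fin_le B.served
  · rw [← Finset.sum_mul, Finset.sum_sub_distrib, ← div_eq_mul_inv, le_div_iff₀ hK']
    simp only [Finset.sum_const, Finset.card_univ, Fintype.card_prod, Fintype.card_fin,
      nsmul_eq_mul, Nat.cast_mul]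
    linarith [hZ.sum_multiplicity_le]

theorem optimalDoF_le_of_le_deliveryTime {μ : Measure (Channel K L)} {γ b : ℝ} {C : ℕ}
    (hb : 0 < b) (h : ENNReal.ofReal (K * (1 - γ) / b) ≤ deliveryTime N μ γ C) :
    optimalDoF N μ γ C ≤ ENNReal.ofReal b := by
  refine ENNReal.div_le_of_le_mul ?_
  calc ENNReal.ofReal (K * (1 - γ)) = ENNReal.ofReal b * ENNReal.ofReal (K * (1 - γ) / b) := by
        rw [← ENNReal.ofReal_mul hb.le, mul_div_cancel₀ _ hb.ne']
    _ ≤ ENNReal.ofReal b * deliveryTime N μ γ C := by gcongr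

theorem optimalDoF_le_add {μ : Measure (Channel K L)} [NeZero μ]
    (hμ : ∀ᵐ H ∂μ, IsTotallyNonsingular (Matrix.of H)) (hL : 1 ≤ L) (hN : K ≤ N) {γ : ℝ}
    (hγ : 0 ≤ γ) (C : ℕ) : optimalDoF N μ γ C ≤ ENNReal.ofReal (L + K * γ) := by
  have : (0 : ℝ) < L := by exact_mod_cast hL
  exact optimalDoF_le_of_le_deliveryTime (by positivity) (div_le_deliveryTime hμ hL hN hγ C)

theorem optimalDoF_le_card_users (μ : Measure (Channel K L)) (hK : 0 < K) (hN : K ≤ N) (γ : ℝ)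
    (C : ℕ) : optimalDoF N μ γ C ≤ K := by
  have hK' : (0 : ℝ) < K := by exact_mod_cast hK
  rw [← ENNReal.ofReal_natCast]
  refine optimalDoF_le_of_le_deliveryTime hK' ?_
  rw [mul_div_cancel_left₀ _ hK'.ne']
  exact ofReal_one_sub_le_deliveryTime μ hK hN γ C

end Converse

section ZeroForcing

/-- The zero-forcing precoder for user `e` on the antennas `ι`: a column of the adjugate of the
conjugated channel matrix, which unlike a column of the inverse needs no division. -/
def zfPrecoder {n : ℕ} (ι : Fin n ↪ Fin L) (M : Channel n L) (e : Fin n) : Fin L → ℂ :=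
  ∑ b, ((conjChannel M).submatrix id ι).adjugate b e • Pi.single (ι b) 1

theorem measurable_zfPrecoder {n : ℕ} (ι : Fin n ↪ Fin L) (e : Fin n) :
    Measurable fun M : Channel n L => zfPrecoder ι M e := by
  apply Continuous.measurable
  unfold zfPrecoder conjChannel
  fun_prop

theorem mulVec_zfPrecoder {n : ℕ} {m : Type*} (ι : Fin n ↪ Fin L) (M : Channel n L) (e : Fin n)
    (A : Matrix m (Fin L) ℂ) (k : m) : (A *ᵥ zfPrecoder ι M e) k =
      (((conjChannel M).submatrix id ι).updateRow e (A k ∘ ι)).det := by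
  rw [← vecMul_adjugate_apply, zfPrecoder, Matrix.mulVec, dotProduct_sum]
  simp [Matrix.vecMul, dotProduct, Pi.single_apply, mul_comm]

theorem submatrix_updateRow_comp {l m n o R : Type*} [DecidableEq l] (A : Matrix m n R)
    (ρ : l → m) (κ : o → n) (a : l) (i : m) :
    (A.submatrix ρ κ).updateRow a (A i ∘ κ) = A.submatrix (Function.update ρ a i) κ := by
  ext b j
  rcases eq_or_ne b a with rfl | hb
  · simp
  · simp [hb]

variable {t n : ℕ} [NeZero n]

/-- The user whose zero-forcing precoder is used at each slot: the users without feedback, at the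
slots `inl i`, share the precoder of the first user with feedback. -/
def beam : Fin t ⊕ Fin n → Fin n := Sum.elim (fun _ => 0) id

/-- The block serving the users `ν r` with the packets `pkt r`, where the users at the slots
`inr e` feed back their channels and are zero-forced. -/
noncomputable def zfBlock (ι : Fin n ↪ Fin L) (ν : Fin t ⊕ Fin n ↪ Fin K)
    (pkt : Fin t ⊕ Fin n → Fin F) : Block K L F where
  served := Finset.univ.map ν
  packet k := pkt (Function.invFun ν k)
  feedback := Finset.univ.map (Function.Embedding.inr.trans ν)
  precoder k Hf := zfPrecoder ι
    (fun e => Hf ⟨ν (Sum.inr e), Finset.mem_map_of_mem (Function.Embedding.inr.trans ν)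
      (Finset.mem_univ e)⟩)
    (beam (Function.invFun ν k))

variable {ι : Fin n ↪ Fin L} {ν : Fin t ⊕ Fin n ↪ Fin K} {pkt : Fin t ⊕ Fin n → Fin F}

theorem zfBlock_packet (r : Fin t ⊕ Fin n) : (zfBlock ι ν pkt).packet (ν r) = pkt r :=
  congrArg pkt (Function.leftInverse_invFun ν.injective r)

theorem forall_mem_zfBlock_served {p : Fin K → Prop} :
    (∀ k ∈ (zfBlock ι ν pkt).served, p k) ↔ ∀ r, p (ν r) := by
  refine ⟨fun h r => h _ (Finset.mem_map_of_mem ν (Finset.mem_univ r)), fun h k hk => ?_⟩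
  obtain ⟨r, -, rfl⟩ := Finset.mem_map.1 hk
  exact h r

theorem mem_zfBlock_served_and_packet_eq_iff {k : Fin K} {f : Fin F} :
    k ∈ (zfBlock ι ν pkt).served ∧ (zfBlock ι ν pkt).packet k = f ↔
      ∃ r, ν r = k ∧ pkt r = f := by
  constructor
  · rintro ⟨hk, rfl⟩
    obtain ⟨r, -, rfl⟩ := Finset.mem_map.1 hk
    exact ⟨r, rfl, (zfBlock_packet r).symm⟩
  · rintro ⟨r, rfl, rfl⟩
    exact ⟨Finset.mem_map_of_mem ν (Finset.mem_univ r), zfBlock_packet r⟩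

theorem zfBlock_gain (H : Channel K L) (r r' : Fin t ⊕ Fin n) :
    (zfBlock ι ν pkt).gain H (ν r) (ν r') =
      ((conjChannel H).submatrix (Function.update (ν ∘ Sum.inr) (beam r') (ν r)) ι).det := by
  have hinv : Function.invFun ν (ν r') = r' := Function.leftInverse_invFun ν.injective r'
  rw [← submatrix_updateRow_comp, Block.gain, zfBlock, mulVec_zfPrecoder, hinv]
  rfl

theorem injective_update_beam (r : Fin t ⊕ Fin n) :
    (Function.update (ν ∘ Sum.inr) (beam r) (ν r)).Injective := by
  rcases r with i | e
  · intro a b hab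
    by_cases ha : a = beam (.inl i : Fin t ⊕ Fin n) <;>
      by_cases hb : b = beam (.inl i : Fin t ⊕ Fin n) <;>
      simp_all
  · have hself : Function.update (ν ∘ Sum.inr) (beam (.inr e : Fin t ⊕ Fin n)) (ν (.inr e)) =
        ν ∘ Sum.inr := Function.update_eq_self e (ν ∘ Sum.inr)
    rw [hself]
    exact ν.injective.comp Sum.inr_injective

theorem zfBlock_gain_self_ne_zero {H : Channel K L} (hH : IsTotallyNonsingular (Matrix.of H))
    (r : Fin t ⊕ Fin n) : (zfBlock ι ν pkt).gain H (ν r) (ν r) ≠ 0 := by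
  rw [zfBlock_gain]
  exact isTotallyNonsingular_conjChannel hH ⟨_, injective_update_beam r⟩ ι

theorem zfBlock_gain_eq_zero (H : Channel K L) {e : Fin n} {r : Fin t ⊕ Fin n}
    (he : e ≠ beam r) : (zfBlock ι ν pkt).gain H (ν (Sum.inr e)) (ν r) = 0 := by
  rw [zfBlock_gain]
  refine Matrix.det_zero_of_row_eq he ?_
  ext b
  simp [he]

theorem ncard_zfBlock_precoder_le :
    ((zfBlock ι ν pkt).precoder '' ((zfBlock ι ν pkt).served : Set (Fin K))).ncard ≤ n := by
  let P : Fin n → ({j // j ∈ (zfBlock ι ν pkt).feedback} → Fin L → ℂ) → Fin L → ℂ :=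
    fun e Hf => zfPrecoder ι (fun e' => Hf ⟨ν (Sum.inr e'),
      Finset.mem_map_of_mem (Function.Embedding.inr.trans ν) (Finset.mem_univ e')⟩) e
  calc ((zfBlock ι ν pkt).precoder '' ((zfBlock ι ν pkt).served : Set (Fin K))).ncard
      ≤ (P '' Set.univ).ncard := Set.ncard_le_ncard <| by
        rintro _ ⟨k, -, rfl⟩
        exact ⟨beam (Function.invFun ν k), trivial, rfl⟩
    _ ≤ (Set.univ : Set (Fin n)).ncard := Set.ncard_image_le
    _ = n := by rw [Set.ncard_univ, Nat.card_fin]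

theorem zfBlock_admissible {μ : Measure (Channel K L)}
    (hμ : ∀ᵐ H ∂μ, IsTotallyNonsingular (Matrix.of H)) {C : ℕ} (hC : n ≤ C)
    {Z : Placement K N F} {d : Fin K ↪ Fin N} (hneed : ∀ r, (d (ν r), pkt r) ∉ Z (ν r))
    (hnull : ∀ r r', r ≠ r' → (d (ν r'), pkt r') ∉ Z (ν r) → ∃ e, r = Sum.inr e ∧ e ≠ beam r') :
    (zfBlock ι ν pkt).Admissible μ C Z d where
  needed := forall_mem_zfBlock_served.2 fun r => by
    rw [zfBlock_packet]
    exact hneed r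
  feedback_subset := by
    intro k hk
    obtain ⟨e, -, rfl⟩ := Finset.mem_map.1 hk
    exact Finset.mem_map_of_mem ν (Finset.mem_univ (Sum.inr e))
  feedback_card := by simpa [zfBlock] using hC
  precoder_card := ncard_zfBlock_precoder_le.trans hC
  precoder_measurable _ _ :=
    (measurable_zfPrecoder ι _).comp (measurable_pi_lambda _ fun _ => measurable_pi_apply _)
  decodable := by
    filter_upwards [hμ] with H hH
    refine forall_mem_zfBlock_served.2 fun r => ?_
    rw [Block.decodableAt_iff _ Z d H (Finset.mem_map_of_mem ν (Finset.mem_univ r))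
      (by rw [zfBlock_packet]; exact hneed r)]
    refine ⟨zfBlock_gain_self_ne_zero hH r, forall_mem_zfBlock_served.2 fun r' hne hmiss => ?_⟩
    rw [zfBlock_packet] at hmiss
    obtain ⟨e, rfl, he⟩ := hnull r r' (fun h => hne (h ▸ rfl)) hmiss
    exact zfBlock_gain_eq_zero H he

end ZeroForcing

section Scheme

variable {t m n : ℕ}

/-- The users are placed into `t` caching slots and `m` further, cyclically ordered, slots. -/
abbrev Arrangement (K t m : ℕ) : Type := (Fin t ⊕ Fin m) ≃ Fin K

/-- The label of a packet of a file: the arrangement determines who caches the packet; the second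
component, a served slot, only tells apart the packets with the same arrangement. -/
abbrev Label (K t m n : ℕ) : Type := Arrangement K t m × (Fin t ⊕ Fin n)

/-- The packets of an arrangement are cached at the users in its caching slots. -/
noncomputable def arrangementPlacement (K N t m n : ℕ) :
    Placement K N (Fintype.card (Label K t m n)) :=
  fun k => Finset.univ.filter fun p =>
    ∃ i, ((Fintype.equivFin (Label K t m n)).symm p.2).1 (Sum.inl i) = k

theorem mem_arrangementPlacement {k : Fin K} {a : Fin N} {q : Label K t m n} :
    (a, Fintype.equivFin _ q) ∈ arrangementPlacement K N t m n k ↔ ∃ i, q.1 (Sum.inl i) = k := by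
  simp [arrangementPlacement]

theorem notMem_arrangementPlacement {k : Fin K} {a : Fin N} {q : Label K t m n} :
    (a, Fintype.equivFin _ q) ∉ arrangementPlacement K N t m n k ↔
      ∃ j, q.1 (Sum.inr j) = k := by
  rw [mem_arrangementPlacement]
  obtain ⟨x, rfl⟩ := q.1.surjective k
  rcases x with i | j <;> simp

theorem multiplicity_arrangementPlacement (p : Fin N × Fin (Fintype.card (Label K t m n))) :
    (arrangementPlacement K N t m n).multiplicity p = t := by
  obtain ⟨a, f⟩ := p
  obtain ⟨q, rfl⟩ := (Fintype.equivFin (Label K t m n)).surjective f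
  have hcachers : (Finset.univ.filter fun k => ∃ i, q.1 (Sum.inl i) = k) =
      Finset.univ.map (Function.Embedding.inl.trans q.1.toEmbedding) := by
    ext k
    simp
  simp only [Placement.multiplicity, mem_arrangementPlacement]
  rw [hcachers, Finset.card_map, Finset.card_fin]

theorem card_arrangementPlacement_eq (k k' : Fin K) :
    (arrangementPlacement K N t m n k).card = (arrangementPlacement K N t m n k').card := by
  let σ : Label K t m n ≃ Label K t m n :=
    ((Equiv.refl _).equivCongr (Equiv.swap k k')).prodCongr (Equiv.refl _)
  refine Finset.card_equiv ((Equiv.refl (Fin N)).prodCongr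
    ((Fintype.equivFin _).permCongr σ)) fun ⟨a, f⟩ => ?_
  obtain ⟨q, rfl⟩ := (Fintype.equivFin (Label K t m n)).surjective f
  have hσ : (Equiv.refl (Fin N)).prodCongr ((Fintype.equivFin (Label K t m n)).permCongr σ)
      (a, Fintype.equivFin _ q) = (a, Fintype.equivFin _ (σ q)) := by simp [Equiv.permCongr_apply]
  rw [hσ, mem_arrangementPlacement, mem_arrangementPlacement]
  refine exists_congr fun i => ?_
  change _ ↔ Equiv.swap k k' (q.1 (Sum.inl i)) = k'
  rw [Equiv.swap_apply_eq_iff, Equiv.swap_apply_right]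

theorem fits_arrangementPlacement (K N t m n : ℕ) :
    (arrangementPlacement K N t m n).Fits (t / K) := by
  intro k
  have hsum := (arrangementPlacement K N t m n).sum_multiplicity
  simp only [multiplicity_arrangementPlacement, card_arrangementPlacement_eq _ k,
    Finset.sum_const, Finset.card_univ, Fintype.card_fin, Fintype.card_prod (Fin N),
    smul_eq_mul] at hsum
  have hK : (0 : ℝ) < K := by exact_mod_cast k.pos
  have hsum' : (N * Fintype.card (Label K t m n) * t : ℝ) =
      K * (arrangementPlacement K N t m n k).card := by exact_mod_cast hsum
  rw [div_mul_eq_mul_div, le_div_iff₀ hK]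
  linarith

/-- The slots served in the block with offset `c`: the caching ones and `n` consecutive others. -/
def slot [NeZero m] (hnm : n ≤ m) (c : Fin m) : Fin t ⊕ Fin n ↪ Fin t ⊕ Fin m :=
  (Function.Embedding.refl _).sumMap ((Fin.castLEEmb hnm).trans (addLeftEmbedding c))

/-- The arrangement labelling the packet sent to the user at slot `r` in the block `(g, c)`. A user
at a caching slot has all packets of `g`, so it receives a packet of the arrangement in which it
trades places with the user at `inr c`, the first of the served users with feedback: this packet is
cached by that user and by the other users at caching slots. -/
def relabel (g : Arrangement K t m) (c : Fin m) : Fin t ⊕ Fin n → Arrangement K t m :=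
  Sum.elim (fun i => (Equiv.swap (Sum.inl i) (Sum.inr c)).trans g) fun _ => g

theorem relabel_inr_eq_slot [NeZero m] (hnm : n ≤ m) (g : Arrangement K t m) (c : Fin m)
    (r : Fin t ⊕ Fin n) : ∃ j, relabel g c r (Sum.inr j) = g (slot hnm c r) := by
  rcases r with i | e
  · exact ⟨c, by simp [relabel, slot]⟩
  · exact ⟨c + Fin.castLE hnm e, rfl⟩

theorem exists_relabel_inl_eq_slot_or [NeZero m] [NeZero n] (hnm : n ≤ m) (g : Arrangement K t m)
    (c : Fin m) {r r' : Fin t ⊕ Fin n} (hne : r ≠ r') :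
    (∃ i, relabel g c r' (Sum.inl i) = g (slot hnm c r)) ∨ ∃ e, r = Sum.inr e ∧ e ≠ beam r' := by
  rcases r with i | e <;> rcases r' with i' | e'
  · have hi : i ≠ i' := fun h => hne (congrArg _ h)
    refine .inl ⟨i, ?_⟩
    simp [relabel, slot, Equiv.swap_apply_of_ne_of_ne, hi]
  · exact .inl ⟨i, rfl⟩
  · rcases eq_or_ne e 0 with rfl | he
    · have hfirst : c + Fin.castLE hnm 0 = c := by
        rw [show Fin.castLE hnm 0 = 0 from Fin.ext (by simp), add_zero]
      exact .inl ⟨i', by simp [relabel, slot, hfirst]⟩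
    · exact .inr ⟨e, rfl, he⟩
  · exact .inr ⟨e, rfl, fun h => hne (congrArg _ h)⟩

theorem existsUnique_slot_eq_and_relabel_eq [NeZero m] (hnm : n ≤ m) (g' : Arrangement K t m)
    (r : Fin t ⊕ Fin n) (q : Fin m) : ∃! x : Arrangement K t m × Fin m,
      x.1 (slot hnm x.2 r) = g' (Sum.inr q) ∧ relabel x.1 x.2 r = g' := by
  rcases r with i | e
  · refine ⟨((Equiv.swap (Sum.inl i) (Sum.inr q)).trans g', q), ⟨by simp [slot], ?_⟩, ?_⟩
    · ext x
      simp [relabel]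
    · rintro ⟨g, c⟩ ⟨hslot, rfl⟩
      obtain rfl : q = c := by
        simpa [slot] using Equiv.swap_apply_eq_iff.1 (g.injective hslot).symm
      refine Prod.ext ?_ rfl
      ext x
      simp [relabel]
  · refine ⟨(g', q - Fin.castLE hnm e), ⟨by simp [slot], rfl⟩, ?_⟩
    rintro ⟨g, c⟩ ⟨hslot, rfl⟩
    have hc : c + Fin.castLE hnm e = q := by simpa [slot, relabel] using hslot
    exact Prod.ext rfl (eq_sub_of_add_eq hc)

/-- The block with arrangement `x.1` and offset `x.2`. -/
noncomputable def schemeBlock [NeZero m] [NeZero n] (hn : n ≤ L) (hnm : n ≤ m)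
    (x : Arrangement K t m × Fin m) : Block K L (Fintype.card (Label K t m n)) :=
  zfBlock (Fin.castLEEmb hn) ((slot hnm x.2).trans x.1.toEmbedding)
    fun r => Fintype.equivFin _ (relabel x.1 x.2 r, r)

theorem schemeBlock_admissible [NeZero m] [NeZero n] {μ : Measure (Channel K L)}
    (hμ : ∀ᵐ H ∂μ, IsTotallyNonsingular (Matrix.of H)) {C : ℕ} (hC : n ≤ C) (hn : n ≤ L)
    (hnm : n ≤ m) (d : Fin K ↪ Fin N) (x : Arrangement K t m × Fin m) :
    (schemeBlock hn hnm x).Admissible μ C (arrangementPlacement K N t m n) d :=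
  zfBlock_admissible hμ hC
    (fun r => notMem_arrangementPlacement.2 (relabel_inr_eq_slot hnm x.1 x.2 r))
    fun _ _ hne hmiss => (exists_relabel_inl_eq_slot_or hnm x.1 x.2 hne).resolve_left
      fun h => hmiss (mem_arrangementPlacement.2 h)

theorem schemeBlock_sends_iff [NeZero m] [NeZero n] (hn : n ≤ L) (hnm : n ≤ m)
    (x : Arrangement K t m × Fin m) {k : Fin K} {g : Arrangement K t m} {r : Fin t ⊕ Fin n} :
    (k ∈ (schemeBlock hn hnm x).served ∧
        (schemeBlock hn hnm x).packet k = Fintype.equivFin (Label K t m n) (g, r)) ↔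
      x.1 (slot hnm x.2 r) = k ∧ relabel x.1 x.2 r = g := by
  rw [schemeBlock, mem_zfBlock_served_and_packet_eq_iff]
  simp only [EmbeddingLike.apply_eq_iff_eq, Prod.mk.injEq]
  exact ⟨fun ⟨r', hk, hg, hr⟩ => hr ▸ ⟨hk, hg⟩, fun ⟨hk, hg⟩ => ⟨r, hk, hg, rfl⟩⟩

theorem deliverable_of_fintype {β : Type*} [Fintype β] {μ : Measure (Channel K L)} {C : ℕ}
    {Z : Placement K N F} {d : Fin K ↪ Fin N} (B : β → Block K L F)
    (hadm : ∀ b, (B b).Admissible μ C Z d)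
    (hsent : ∀ k f, (d k, f) ∉ Z k → ∃! b, k ∈ (B b).served ∧ (B b).packet k = f) :
    Deliverable μ C Z d (Fintype.card β) :=
  ⟨B ∘ (Fintype.equivFin β).symm, fun _ => hadm _, fun k f hk =>
    ((Fintype.equivFin β).symm.existsUnique_congr fun _ => Iff.rfl).2 (hsent k f hk)⟩

theorem deliverable_arrangementPlacement [NeZero m] [NeZero n] {μ : Measure (Channel K L)}
    (hμ : ∀ᵐ H ∂μ, IsTotallyNonsingular (Matrix.of H)) {C : ℕ} (hC : n ≤ C) (hn : n ≤ L)
    (hnm : n ≤ m) (d : Fin K ↪ Fin N) :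
    Deliverable μ C (arrangementPlacement K N t m n) d
      (Fintype.card (Arrangement K t m × Fin m)) := by
  refine deliverable_of_fintype (schemeBlock hn hnm) (schemeBlock_admissible hμ hC hn hnm d)
    fun k f hk => ?_
  obtain ⟨⟨g, r⟩, rfl⟩ := (Fintype.equivFin (Label K t m n)).surjective f
  obtain ⟨q, rfl⟩ := notMem_arrangementPlacement.1 hk
  simp only [schemeBlock_sends_iff]
  exact existsUnique_slot_eq_and_relabel_eq hnm g r q

end Scheme

section Achievability

variable {μ : Measure (Channel K L)}

theorem deliveryTime_le (hμ : ∀ᵐ H ∂μ, IsTotallyNonsingular (Matrix.of H)) {t m n C : ℕ}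
    (hK : t + m = K) (hn : 0 < n) (hnm : n ≤ m) (hnL : n ≤ L) (hC : n ≤ C) :
    deliveryTime N μ (t / K) C ≤ (m : ℝ≥0∞) / ((t + n : ℕ) : ℝ≥0∞) := by
  have : NeZero m := ⟨by omega⟩
  have : NeZero n := ⟨hn.ne'⟩
  have g : Arrangement K t m := finSumFinEquiv.trans (finCongr hK)
  have hcard : 0 < Fintype.card (Arrangement K t m) := Fintype.card_pos_iff.2 ⟨g⟩
  have hF : 0 < Fintype.card (Label K t m n) := Fintype.card_pos_iff.2 ⟨(g, Sum.inr 0)⟩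
  calc deliveryTime N μ (t / K) C
      ≤ placementTime μ C (arrangementPlacement K N t m n) :=
        (iInf₂_le _ hF).trans
          (iInf₂_le (arrangementPlacement K N t m n) (fits_arrangementPlacement K N t m n))
    _ ≤ (Fintype.card (Arrangement K t m × Fin m) : ℝ≥0∞) / Fintype.card (Label K t m n) :=
        iSup_le fun d => iInf₂_le _ (deliverable_arrangementPlacement hμ hC hnL hnm d)
    _ = m / ((t + n : ℕ) : ℝ≥0∞) := by
        rw [Fintype.card_prod, Fintype.card_prod, Fintype.card_sum, Fintype.card_fin,
          Fintype.card_fin, Fintype.card_fin, Nat.cast_mul, Nat.cast_mul]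
        exact ENNReal.mul_div_mul_left _ _ (by exact_mod_cast hcard.ne') (ENNReal.natCast_ne_top _)

theorem min_le_optimalDoF (hμ : ∀ᵐ H ∂μ, IsTotallyNonsingular (Matrix.of H)) (hL : 1 ≤ L)
    {t C : ℕ} (ht : t < K) (hC : min L (K - t) ≤ C) :
    ((min (L + t) K : ℕ) : ℝ≥0∞) ≤ optimalDoF N μ (t / K) C := by
  have hK : (0 : ℝ) < K := by exact_mod_cast (by omega : 0 < K)
  have hnumerator : ENNReal.ofReal (K * (1 - t / K)) = ((K - t : ℕ) : ℝ≥0∞) := by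
    rw [← ENNReal.ofReal_natCast, Nat.cast_sub ht.le, mul_one_sub, mul_div_cancel₀ _ hK.ne']
  have htime := deliveryTime_le (N := N) hμ (Nat.add_sub_cancel' ht.le)
    (by omega : 0 < min L (K - t)) (min_le_right _ _) (min_le_left _ _) hC
  rw [show t + min L (K - t) = min (L + t) K by omega] at htime
  have hpos : ((K - t : ℕ) : ℝ≥0∞) ≠ 0 := by exact_mod_cast (by omega : K - t ≠ 0)
  rw [optimalDoF, hnumerator,
    ENNReal.le_div_iff_mul_le (.inr hpos) (.inr (ENNReal.natCast_ne_top _))]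
  calc ((min (L + t) K : ℕ) : ℝ≥0∞) * deliveryTime N μ (t / K) C
      ≤ (min (L + t) K : ℕ) * (((K - t : ℕ) : ℝ≥0∞) / (min (L + t) K : ℕ)) := by gcongr
    _ ≤ (K - t : ℕ) := ENNReal.mul_div_le

theorem optimalDoF_eq_min [NeZero μ] (hμ : ∀ᵐ H ∂μ, IsTotallyNonsingular (Matrix.of H))
    (hL : 1 ≤ L) (hN : K ≤ N) {t C : ℕ} (ht : t < K) (hC : min L (K - t) ≤ C) :
    optimalDoF N μ (t / K) C = ((min (L + t) K : ℕ) : ℝ≥0∞) := by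
  refine le_antisymm ?_ (min_le_optimalDoF hμ hL ht hC)
  have hK : (K : ℝ) ≠ 0 := by exact_mod_cast (by omega : K ≠ 0)
  have hadd := optimalDoF_le_add hμ hL hN (γ := t / K) (by positivity) C
  rw [mul_div_cancel₀ _ hK, ← Nat.cast_add, ENNReal.ofReal_natCast] at hadd
  rw [(Nat.mono_cast (α := ℝ≥0∞)).map_min]
  exact le_min hadd (optimalDoF_le_card_users μ (by omega) hN _ C)

end Achievability

end CacheMISO

theorem mainTheorem3_general {K N L : ℕ} (hL : 1 ≤ L) (hN : K ≤ N)
    {μ : Measure (CacheMISO.Channel K L)} [NeZero μ]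
    (hμ : ∀ᵐ H ∂μ, CacheMISO.IsTotallyNonsingular (Matrix.of H)) :
    (∀ t : ℕ, t < K → ∀ C : ℕ, min L (K - t) ≤ C →
      CacheMISO.optimalDoF N μ (t / K) C = ((min (L + t) K : ℕ) : ℝ≥0∞)) ∧
    ∀ γ : ℝ, 0 ≤ γ → γ ≤ 1 → ∀ C : ℕ,
      CacheMISO.optimalDoF N μ γ C ≤ ENNReal.ofReal (L + K * γ) :=
  ⟨fun _ ht _ hC => CacheMISO.optimalDoF_eq_min hμ hL hN ht hC,
    fun _ hγ _ C => CacheMISO.optimalDoF_le_add hμ hL hN hγ C⟩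

theorem mainTheorem3 (K N L : ℕ) (hL : 1 ≤ L) (hN : K ≤ N)
    (μ : MeasureTheory.Measure (CacheMISO.Channel K L)) [MeasureTheory.IsProbabilityMeasure μ]
    (hμ : μ.AbsolutelyContinuous MeasureTheory.volume) :
    (∀ t : ℕ, t < K →
      CacheMISO.fullDoF N μ ((t : ℝ) / (K : ℝ)) = ((min (L + t) K : ℕ) : ENNReal) ∧
      ∀ C : ℕ, L ≤ C →
        CacheMISO.optimalDoF N μ ((t : ℝ) / (K : ℝ)) C = ((min (L + t) K : ℕ) : ENNReal)) ∧
    ∀ γ : ℝ, 0 ≤ γ → γ ≤ 1 → ∀ C : ℕ,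
      CacheMISO.optimalDoF N μ γ C ≤ ENNReal.ofReal ((L : ℝ) + (K : ℝ) * γ) :=
  let ⟨hmin, hadd⟩ :=
    mainTheorem3_general hL hN (CacheMISO.ae_isTotallyNonsingular_channel hμ)
  ⟨fun t ht => ⟨hmin t ht K (by omega), fun C hC => hmin t ht C (by omega)⟩, hadd⟩
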